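/- Let $K$ be an infinite field of characteristic different from $2$, and let $U_1=\mathrm{Der}_K(K[t,t^{-1}])$ be the Lie algebra of the $K$-derivations of the algebra of Laurent polynomials, with its natural $\mathbb{Z}$-grading $U_1=\bigoplus_{n\in\mathbb{Z}}L_n$, where $L_n$ is the span of $e_n=t^{n+1}\,d/dt$. Let $L\langle X_{\mathbb{Z}}\rangle$ be the free $\mathbb{Z}$-graded Lie algebra over $K$ freely generated by the variables $x_1^{g},x_2^{g},\dots$ of degree $g$, for every $g\in\mathbb{Z}$. A graded identity of $U_1$ is an element of $L\langle X_{\mathbb{Z}}\rangle$ that vanishes whenever each of its variables $x_i^{g}$ is replaced by an element of $L_g$; the graded identities form an ideal $T_{\mathbb{Z}}(U_1)$ of $L\langle X_{\mathbb{Z}}\rangle$. A $T_{\mathbb{Z}}$-ideal is an ideal of $L\langle X_{\mathbb{Z}}\rangle$ that is invariant under all endomorphisms of $L\langle X_{\mathbb{Z}}\rangle$ as a $\mathbb{Z}$-graded Lie algebra, and the $T_{\mathbb{Z}}$-ideal generated by a set $S$ is the intersection of all $T_{\mathbb{Z}}$-ideals that contain $S$. Then the $\mathbb{Z}$-graded identities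 of $U_1$ do not admit any finite basis: there is no finite set $S\subset L\langle X_{\mathbb{Z}}\rangle$ such that $T_{\mathbb{Z}}(U_1)$ is the $T_{\mathbb{Z}}$-ideal generated by $S$. -/

import Mathlib

open scoped LaurentPolynomial

noncomputable section

namespace GradedLie

section Free

variable (K : Type*) [Field K] (G : Type*) [AddCommGroup G]

/-- The free Lie algebra `L⟨X_G⟩` on the variables `x_i^g`, for `g` in `G` and `i` in `ℕ`; the
variable `x_i^g` is `FreeLieAlgebra.of K (g, i)`. -/
abbrev FreeLie : Type _ := FreeLieAlgebra K (G × ℕ)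

variable {K G}

/-- `IsMonomialOfDegree g m`: `m` is a (non-associative) Lie monomial in the variables, and the
degrees of the variables occurring in it, with multiplicity, add up to `g`. -/
inductive IsMonomialOfDegree : G → FreeLie K G → Prop
  | of (g : G) (i : ℕ) : IsMonomialOfDegree g (FreeLieAlgebra.of K (g, i))
  | lie {g h : G} {m n : FreeLie K G} :
      IsMonomialOfDegree g m → IsMonomialOfDegree h n → IsMonomialOfDegree (g + h) ⁅m, n⁆

variable (K) in
/-- The homogeneous component of degree `g` of the free `G`-graded Lie algebra `L⟨X_G⟩`. -/
def freeComponent (g : G) : Submodule K (FreeLie K G) :=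
  Submodule.span K {m | IsMonomialOfDegree g m}

/-- An endomorphism of `L⟨X_G⟩` as a `G`-graded Lie algebra. -/
def IsGradedEndomorphism (φ : FreeLie K G →ₗ⁅K⁆ FreeLie K G) : Prop :=
  ∀ g : G, ∀ f ∈ freeComponent K g, φ f ∈ freeComponent K g

/-- A `T_G`-ideal of `L⟨X_G⟩`: an ideal that is invariant under all graded endomorphisms. -/
def IsTIdeal (I : LieIdeal K (FreeLie K G)) : Prop :=
  ∀ φ : FreeLie K G →ₗ⁅K⁆ FreeLie K G, IsGradedEndomorphism φ → ∀ f ∈ I, φ f ∈ I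

/-- The `T_G`-ideal `⟨S⟩_G` generated by `S`: the intersection of all `T_G`-ideals that
contain `S`. -/
def tIdealSpan (S : Set (FreeLie K G)) : LieIdeal K (FreeLie K G) :=
  sInf {I | IsTIdeal I ∧ S ⊆ (I : Set (FreeLie K G))}

/-- The `T_G`-ideal `I` has a finite basis: it is generated, as a `T_G`-ideal, by a finite set. -/
def HasFiniteBasis (I : LieIdeal K (FreeLie K G)) : Prop :=
  ∃ S : Set (FreeLie K G), S.Finite ∧ tIdealSpan S = I

end Free

section Identities

variable {K : Type*} [Field K] {G : Type*} [AddCommGroup G]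
variable {L : Type*} [LieRing L] [LieAlgebra K L]

/-- An admissible substitution in a Lie algebra with homogeneous components `ℒ g`: every variable
of degree `g` is replaced by an element of `ℒ g`. -/
def IsAdmissible (ℒ : G → Submodule K L) (v : G × ℕ → L) : Prop :=
  ∀ g i, v (g, i) ∈ ℒ g

/-- The ideal `T_G(L)` of the graded identities of a Lie algebra `L` with homogeneous components
`ℒ g`: the polynomials that vanish under every admissible substitution. -/
def gradedIdentities (ℒ : G → Submodule K L) : LieIdeal K (FreeLie K G) where
  carrier := {f | ∀ v : G × ℕ → L, IsAdmissible ℒ v → FreeLieAlgebra.lift K v f = 0}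
  add_mem' hf hg v hv := by rw [map_add, hf v hv, hg v hv, add_zero]
  zero_mem' v _ := map_zero _
  smul_mem' c f hf v hv := by rw [map_smul, hf v hv, smul_zero]
  lie_mem {x f} hf v hv := by rw [LieHom.map_lie, hf v hv, lie_zero]

end Identities

section Witt

variable (K : Type*) [Field K]

/-- The Lie algebra `U₁ = Der(K[t, t⁻¹])`, with the commutator of derivations as its bracket. -/
abbrev U₁ : Type _ := Derivation K K[T;T⁻¹] K[T;T⁻¹]

/-- The `K`-linear map `K[t, t⁻¹] → K[t, t⁻¹]` with `t ^ n ↦ n t ^ (n - 1)`. -/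
def ddtLinear : K[T;T⁻¹] →ₗ[K] K[T;T⁻¹] :=
  (Finsupp.linearCombination K
    (fun n : ℤ => (n : K) • (LaurentPolynomial.T (n - 1) : K[T;T⁻¹]))) ∘ₗ
    (AddMonoidAlgebra.coeffLinearEquiv K).toLinearMap

theorem ddtLinear_T (n : ℤ) :
    ddtLinear K (LaurentPolynomial.T n) = (n : K) • LaurentPolynomial.T (n - 1) := by
  simp only [ddtLinear, LinearMap.comp_apply, LinearEquiv.coe_coe]
  change Finsupp.linearCombination K _ (Finsupp.single n (1 : K)) = _
  rw [Finsupp.linearCombination_single, one_smul]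

/-- The derivation `d/dt` of `K[t, t⁻¹]`. -/
def ddt : U₁ K :=
  Derivation.mk' (ddtLinear K) (by
    intro f g
    induction f using LaurentPolynomial.induction_on' with
    | add p q hp hq => simp only [add_mul, map_add, hp, hq, add_smul, smul_add]; abel
    | C_mul_T m a =>
      induction g using LaurentPolynomial.induction_on' with
      | add p q hp hq => simp only [mul_add, map_add, hp, hq, add_smul, smul_add]; abel
      | C_mul_T n b =>
        have h (c : K) (k : ℤ) : LaurentPolynomial.C c * LaurentPolynomial.T k
            = c • (LaurentPolynomial.T k : K[T;T⁻¹]) := by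
          rw [LaurentPolynomial.smul_eq_C_mul]
        simp only [h, map_smul, ddtLinear_T, smul_eq_mul, smul_mul_smul_comm,
          ← LaurentPolynomial.T_add]
        simp only [mul_smul_comm, ← LaurentPolynomial.T_add]
        rw [show n + (m - 1) = m + n - 1 by ring, show m + (n - 1) = m + n - 1 by ring]
        simp only [smul_smul, ← add_smul]
        congr 1
        push_cast
        ring)

/-- The derivation `e_n = t ^ (n + 1) d/dt` of `K[t, t⁻¹]`. -/
def e (n : ℤ) : U₁ K := (LaurentPolynomial.T (n + 1) : K[T;T⁻¹]) • ddt K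

/-- The natural `ℤ`-grading of `U₁`: the component of degree `n` is the span of `e_n`. -/
def component (n : ℤ) : Submodule K (U₁ K) := Submodule.span K {e K n}

end Witt

end GradedLie

end

namespace GradedLie

section Free

variable {K : Type*} [Field K] {G : Type*} [AddCommGroup G]
variable {L : Type*} [LieRing L] [LieAlgebra K L]

/-! Every component of `U₁` is a line, so `[x_1^g, x_2^g]` is an identity for each `g`. A finite set
`S` involves finitely many variables (`exists_finset_lift_eq_zero`), so some `g > 0` exceeds all
their degrees. The Heisenberg algebra with generators in degree `g` and centre in degree `2g` then
satisfies `S` trivially, since every variable of `S` is replaced by zero. Its identities form a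
T-ideal (`isTIdeal_gradedIdentities`) containing `S` but not `[x_1^g, x_2^g]`. -/

/-- An admissible substitution into a graded Lie algebra respects the gradings. -/
theorem lift_mem_of_mem_freeComponent {ℒ : G → Submodule K L}
    (hℒ : ∀ g h, ∀ x ∈ ℒ g, ∀ y ∈ ℒ h, ⁅x, y⁆ ∈ ℒ (g + h))
    {v : G × ℕ → L} (hv : IsAdmissible ℒ v) {g : G} {f : FreeLie K G}
    (hf : f ∈ freeComponent K g) : FreeLieAlgebra.lift K v f ∈ ℒ g := by
  induction hf using Submodule.span_induction with
  | mem m hm =>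
    induction hm with
    | of g i => simpa using hv g i
    | lie _ _ h₁ h₂ => simpa using hℒ _ _ _ h₁ _ h₂
  | zero => simp
  | add x y _ _ hx hy => simpa using add_mem hx hy
  | smul c x _ hx => simpa using (ℒ g).smul_mem c hx

/-- The graded identities of a graded Lie algebra form a `T_G`-ideal. -/
theorem isTIdeal_gradedIdentities {ℒ : G → Submodule K L}
    (hℒ : ∀ g h, ∀ x ∈ ℒ g, ∀ y ∈ ℒ h, ⁅x, y⁆ ∈ ℒ (g + h)) :
    IsTIdeal (gradedIdentities ℒ) := by
  intro φ hφ f hf v hv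
  -- Applying `φ` and then substituting `v` is itself an admissible substitution, at which `f`
  -- vanishes.
  have hcomp : (FreeLieAlgebra.lift K v).comp φ =
      FreeLieAlgebra.lift K fun p ↦ FreeLieAlgebra.lift K v (φ (FreeLieAlgebra.of K p)) := by
    ext p
    simp
  have hadm : IsAdmissible ℒ
      fun p ↦ FreeLieAlgebra.lift K v (φ (FreeLieAlgebra.of K p)) := fun g i ↦
    lift_mem_of_mem_freeComponent hℒ hv
      (hφ g _ (Submodule.subset_span (IsMonomialOfDegree.of g i)))
  have := hf _ hadm
  rwa [← hcomp] at this

/-- Only finitely many variables occur in a Lie polynomial: it vanishes as soon as these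
are replaced by zero. -/
theorem exists_finset_lift_eq_zero (L : Type*) [LieRing L] [LieAlgebra K L] {X : Type*}
    (f : FreeLieAlgebra K X) :
    ∃ V : Finset X, ∀ v : X → L, (∀ p ∈ V, v p = 0) → FreeLieAlgebra.lift K v f = 0 := by
  classical
  -- Induction on Lie polynomials: `H` is a subalgebra containing the generators, hence everything.
  let H : LieSubalgebra K (FreeLieAlgebra K X) :=
    { carrier := {f | ∃ V : Finset X, ∀ v : X → L,
        (∀ p ∈ V, v p = 0) → FreeLieAlgebra.lift K v f = 0}
      add_mem' := by
        rintro a b ⟨V, hV⟩ ⟨W, hW⟩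
        refine ⟨V ∪ W, fun v hv ↦ ?_⟩
        rw [map_add, hV v fun p hp ↦ hv p (Finset.mem_union_left _ hp),
          hW v fun p hp ↦ hv p (Finset.mem_union_right _ hp), add_zero]
      zero_mem' := ⟨∅, fun v _ ↦ map_zero _⟩
      smul_mem' := by
        rintro c a ⟨V, hV⟩
        exact ⟨V, fun v hv ↦ by rw [map_smul, hV v hv, smul_zero]⟩
      lie_mem' := by
        rintro a b ⟨V, hV⟩ -
        exact ⟨V, fun v hv ↦ by rw [LieHom.map_lie, hV v hv, zero_lie]⟩ }
  have hof (p : X) : FreeLieAlgebra.of K p ∈ H :=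
    ⟨{p}, fun v hv ↦ by simpa using hv p (Finset.mem_singleton_self p)⟩
  -- This endomorphism fixes the generators and factors through `H`, which forces `f ∈ H`.
  have hid : H.incl.comp (FreeLieAlgebra.lift K fun p ↦ (⟨_, hof p⟩ : H)) = LieHom.id := by
    ext p
    simp
  have hf := (FreeLieAlgebra.lift K (fun p ↦ (⟨_, hof p⟩ : H)) f).2
  have hval := LieHom.congr_fun hid f
  simp only [LieHom.comp_apply, LieSubalgebra.coe_incl, LieHom.id_apply] at hval
  rwa [hval] at hf

end Free

section Triangular

attribute [local instance 100] LieRing.ofAssociativeRing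

variable (K : Type*) [Field K]

/-- The strictly upper triangular matrices of size three, graded by placing the
`(i, j)` entry in degree `(j - i) g`: the Heisenberg algebra generated in degree `g`. -/
def triangularComponent (g h : ℤ) : Submodule K (Matrix (Fin 3) (Fin 3) K) where
  carrier := {A | ∀ i j, A i j ≠ 0 → i < j ∧ h = ((j : ℤ) - (i : ℤ)) * g}
  add_mem' := by
    intro A B hA hB i j hij
    by_cases h0 : A i j = 0
    · exact hB i j fun h1 ↦ hij (by simp [h0, h1])
    · exact hA i j h0
  zero_mem' := fun i j hij ↦ absurd rfl hij
  smul_mem' := fun c A hA i j hij ↦ hA i j fun h0 ↦ hij (by simp [h0])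

variable {K}

theorem mul_mem_triangularComponent {g h k : ℤ} {A B : Matrix (Fin 3) (Fin 3) K}
    (hA : A ∈ triangularComponent K g h) (hB : B ∈ triangularComponent K g k) :
    A * B ∈ triangularComponent K g (h + k) := by
  intro i j hij
  rw [Matrix.mul_apply] at hij
  obtain ⟨l, -, hl⟩ := Finset.exists_ne_zero_of_sum_ne_zero hij
  obtain ⟨h₁, e₁⟩ := hA i l (left_ne_zero_of_mul hl)
  obtain ⟨h₂, e₂⟩ := hB l j (right_ne_zero_of_mul hl)
  exact ⟨h₁.trans h₂, by rw [e₁, e₂]; ring⟩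

theorem lie_mem_triangularComponent (g h k : ℤ) :
    ∀ A ∈ triangularComponent K g h, ∀ B ∈ triangularComponent K g k,
      ⁅A, B⁆ ∈ triangularComponent K g (h + k) := by
  intro A hA B hB
  rw [Ring.lie_def]
  refine sub_mem (mul_mem_triangularComponent hA hB) ?_
  rw [add_comm]
  exact mul_mem_triangularComponent hB hA

/-- For `i < j` in `Fin 3`, the difference `j - i` is `1` or `2`. -/
theorem eq_zero_of_mem_triangularComponent {g h : ℤ} {A : Matrix (Fin 3) (Fin 3) K}
    (hA : A ∈ triangularComponent K g h) (h₁ : h ≠ g) (h₂ : h ≠ 2 * g) : A = 0 := by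
  ext i j
  by_contra hij
  obtain ⟨hlt, he⟩ := hA i j hij
  fin_cases i <;> fin_cases j <;> simp_all

theorem single_mem_triangularComponent {g h : ℤ} {i j : Fin 3} (hij : i < j)
    (hh : h = ((j : ℤ) - (i : ℤ)) * g) :
    Matrix.single i j (1 : K) ∈ triangularComponent K g h := by
  intro a b hab
  obtain ⟨rfl, rfl⟩ : i = a ∧ j = b := by
    by_contra hne
    exact hab (Matrix.single_apply_of_ne _ _ _ _ _ hne)
  exact ⟨hij, hh⟩

/-- The Heisenberg algebra generated in degree `g` is not commutative in degree `g`. -/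
theorem lie_notMem_gradedIdentities_triangularComponent (g : ℤ) :
    ⁅FreeLieAlgebra.of K (g, 0), FreeLieAlgebra.of K (g, 1)⁆ ∉
      gradedIdentities (triangularComponent K g) := by
  intro hmem
  -- The commutator of `E₀₁` and `E₁₂` is `E₀₂`, read off below at entry `(0, 2)`.
  let v : ℤ × ℕ → Matrix (Fin 3) (Fin 3) K := fun p ↦
    if p.1 = g then (if p.2 = 0 then Matrix.single 0 1 1 else Matrix.single 1 2 1) else 0
  have hv : IsAdmissible (triangularComponent K g) v := by
    intro h i
    simp only [v]
    split_ifs with h₁ h₂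
    · exact single_mem_triangularComponent (by decide) (by simp [h₁])
    · exact single_mem_triangularComponent (by decide) (by simp [h₁])
    · exact zero_mem _
  have h0 := congrFun (congrFun (hmem v hv) 0) 2
  simp [v, Ring.lie_def] at h0

/-- Since only finitely many degrees occur among the variables of a finite set `S`, the
`T`-ideal generated by `S` misses the commutators of variables of some degree. -/
theorem exists_lie_notMem_tIdealSpan {S : Set (FreeLie K ℤ)} (hS : S.Finite) :
    ∃ g : ℤ, ⁅FreeLieAlgebra.of K (g, 0), FreeLieAlgebra.of K (g, 1)⁆ ∉ tIdealSpan S := by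
  classical
  choose V hV using
    fun f : FreeLie K ℤ ↦ exists_finset_lift_eq_zero (Matrix (Fin 3) (Fin 3) K) f
  obtain ⟨N, hN⟩ := ((hS.toFinset.biUnion V).image Prod.fst).bddAbove
  -- Positivity of `g` gives `2 * g > g > N`, so both nonzero degrees lie beyond `N`.
  obtain ⟨g, hg₀, hgN⟩ : ∃ g : ℤ, 0 < g ∧ N < g := ⟨max N 0 + 1, by grind, by grind⟩
  have hSI : S ⊆ (gradedIdentities (triangularComponent K g) : Set (FreeLie K ℤ)) := by
    intro f hf v hv
    refine hV f v fun p hp ↦ ?_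
    have hpN : p.1 ≤ N := hN <| Finset.mem_coe.mpr <| Finset.mem_image_of_mem _ <|
      Finset.mem_biUnion.mpr ⟨f, hS.mem_toFinset.mpr hf, hp⟩
    exact eq_zero_of_mem_triangularComponent (hv p.1 p.2) (by lia) (by lia)
  have hle : tIdealSpan S ≤ gradedIdentities (triangularComponent K g) :=
    sInf_le ⟨isTIdeal_gradedIdentities (lie_mem_triangularComponent g), hSI⟩
  exact ⟨g, fun h ↦ lie_notMem_gradedIdentities_triangularComponent g (hle h)⟩

end Triangular

/-- The homogeneous components of `U₁` are commutative, being of dimension one. -/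
theorem lie_mem_gradedIdentities_component (K : Type*) [Field K] (g : ℤ) (i j : ℕ) :
    ⁅FreeLieAlgebra.of K (g, i), FreeLieAlgebra.of K (g, j)⁆ ∈
      gradedIdentities (component K) := by
  intro v hv
  obtain ⟨a, ha⟩ := Submodule.mem_span_singleton.mp (hv g i)
  obtain ⟨b, hb⟩ := Submodule.mem_span_singleton.mp (hv g j)
  rw [LieHom.map_lie, FreeLieAlgebra.lift_of_apply, FreeLieAlgebra.lift_of_apply, ← ha, ← hb]
  simp

end GradedLie

theorem mainTheorem6 (K : Type*) [Field K] [Infinite K] (hK : ringChar K ≠ 2) :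
    ¬ GradedLie.HasFiniteBasis (GradedLie.gradedIdentities (GradedLie.component K)) := by
  rintro ⟨S, hS, hspan⟩
  obtain ⟨g, hg⟩ := GradedLie.exists_lie_notMem_tIdealSpan hS
  rw [hspan] at hg
  exact hg (GradedLie.lie_mem_gradedIdentities_component K g 0 1)
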